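/- Let $U$ be a normal ultrafilter on a measurable cardinal $\delta$ (that is, a nonprincipal $\delta$-complete ultrafilter on $\delta$ that is closed under diagonal intersections), let $\mathrm{Ult}(V,U)$ be the transitive collapse of the ultrapower of $V$ by $U$, and let $j_U : V \to \mathrm{Ult}(V,U)$ be the induced elementary embedding. Let $\kappa > \delta$ be a regular cardinal. Suppose that there is a $\square(\kappa)$-sequence, that is, a sequence $\langle C_\gamma \mid \gamma \in \mathrm{Lim} \cap \kappa\rangle$ such that 1. $C_\gamma$ is a closed unbounded subset of $\gamma$ for every limit ordinal $\gamma < \kappa$; 2. $C_\beta = C_\gamma \cap \beta$ for every limit ordinal $\gamma < \kappa$ and every limit point $\beta < \gamma$ of $C_\gamma$; 3. there is no closed unbounded subset $C$ of $\kappa$ with $C \cap \gamma = C_\gamma$ for every limit point $\gamma < \kappa$ of $C$. Then there is a closed unbounded subset $A$ of $j_U(\kappa)$ that is fresh over $\mathrm{Ult}(V,U)$, that is, $A \notin \mathrm{Ult}(V,U)$ and $A \cap \alpha \in \mathrm{Ult}(V,U)$ for every $\alpha < \mathrm{lub}(A)$, where $\mathrm{lub}(A)$ is the least upper bound of $A$.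 -/

import Mathlib

universe u

open Cardinal

/-! ### Clubs and square sequences

Sets of ordinals are given as `C : Set Ordinal`; the universe of sets `V` is `ZFSet.{u}`, whose
ordinals are the `α.toZFSet` with `α : Ordinal.{u}`. -/

/-- `β ∈ Lim(C)`: `β` is a limit point of the set `C` of ordinals, i.e. `β ≠ 0` and `C ∩ β` is
unbounded in `β` (so that `β` is a limit ordinal). -/
def IsLimitPoint (C : Set Ordinal.{u}) (β : Ordinal.{u}) : Prop :=
  β ≠ 0 ∧ ∀ α < β, ∃ γ ∈ C, α < γ ∧ γ < β

/-- `C` is a closed unbounded subset of the (limit) ordinal `γ`. -/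
structure IsClubIn (γ : Ordinal.{u}) (C : Set Ordinal.{u}) : Prop where
  subset : C ⊆ Set.Iio γ
  closed : ∀ β < γ, IsLimitPoint C β → β ∈ C
  unbounded : ∀ α < γ, ∃ β ∈ C, α < β

/-- `C` is a `□(κ)`-sequence `⟨C γ | γ ∈ Lim ∩ κ⟩`, for an uncountable regular cardinal `κ`. The
values of `C` outside of `Lim ∩ κ` play no role. -/
structure IsSquareSequence (κ : Cardinal.{u}) (C : Ordinal.{u} → Set Ordinal.{u}) : Prop where
  uncountable : ℵ₀ < κ
  regular : κ.IsRegular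
  club : ∀ γ < κ.ord, Order.IsSuccLimit γ → IsClubIn γ (C γ)
  coherent : ∀ γ < κ.ord, Order.IsSuccLimit γ → ∀ β < γ, IsLimitPoint (C γ) β → C β = C γ ∩ Set.Iio β
  no_thread : ¬ ∃ D : Set Ordinal.{u}, IsClubIn κ.ord D ∧
    ∀ γ < κ.ord, IsLimitPoint D γ → D ∩ Set.Iio γ = C γ

/-! ### Measurable cardinals and normal ultrafilters -/

/-- `D` is a nonprincipal `δ`-complete ultrafilter on `δ`: intersections of fewer than `δ` elements
of `D` belong to `D`. -/
structure IsMeasure (δ : Cardinal.{u}) (D : Ultrafilter (Set.Iio δ.ord)) : Prop where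
  nonprincipal : ∀ α, {α} ∉ D
  complete : CardinalInterFilter (D : Filter (Set.Iio δ.ord)) (Cardinal.lift.{u + 1} δ)

/-- `δ` is an uncountable cardinal carrying a nonprincipal `δ`-complete ultrafilter. -/
def IsMeasurable (δ : Cardinal.{u}) : Prop :=
  ℵ₀ < δ ∧ ∃ D : Ultrafilter (Set.Iio δ.ord), IsMeasure δ D

/-- Normal ultrafilters on a measurable cardinal `δ`: nonprincipal `δ`-complete ultrafilters on `δ`
that are closed under diagonal intersections. -/
structure NormalUltrafilter (δ : Cardinal.{u}) where
  measurable : IsMeasurable δ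
  toUltrafilter : Ultrafilter (Set.Iio δ.ord)
  isMeasure : IsMeasure δ toUltrafilter
  normal : ∀ X : Set.Iio δ.ord → Set (Set.Iio δ.ord), (∀ α, X α ∈ toUltrafilter) →
    {ξ | ∀ α < ξ, ξ ∈ X α} ∈ toUltrafilter

namespace NormalUltrafilter

variable {δ : Cardinal.{u}} (U : NormalUltrafilter δ)

theorem countableInterFilter :
    CountableInterFilter (U.toUltrafilter : Filter (Set.Iio δ.ord)) := by
  have := U.isMeasure.complete
  exact CardinalInterFilter.toCountableInterFilter (c := Cardinal.lift.{u + 1} δ) _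
    (by simpa using U.measurable.1)

/-! ### The ultrapower of the universe and its transitive collapse -/

/-- Classes `[f]` of functions `f : δ → V` modulo `U`. -/
abbrev PreUlt : Type (u + 1) :=
  Filter.Germ (U.toUltrafilter : Filter (Set.Iio δ.ord)) ZFSet.{u}

/-- The membership relation of the ultrapower: `[f] E [g]` iff `{ξ < δ | f ξ ∈ g ξ} ∈ U`. -/
def E (x y : U.PreUlt) : Prop :=
  Filter.Germ.LiftRel (· ∈ ·) x y

theorem E_coe (f g : Set.Iio δ.ord → ZFSet.{u}) :
    U.E (f : U.PreUlt) (g : U.PreUlt) ↔ {ξ | f ξ ∈ g ξ} ∈ U.toUltrafilter :=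
  Iff.rfl

theorem wellFounded_E : WellFounded U.E := by
  have := U.countableInterFilter
  rw [wellFounded_iff_isEmpty_descending_chain]
  refine ⟨fun ⟨x, hx⟩ => ?_⟩
  choose f hf using fun n => Quotient.exists_rep (x n)
  have h : ∀ n, ∀ᶠ ξ in (U.toUltrafilter : Filter (Set.Iio δ.ord)), f (n + 1) ξ ∈ f n ξ := by
    intro n
    have := hx n
    rw [← hf n, ← hf (n + 1)] at this
    exact this
  obtain ⟨ξ, hξ⟩ := (eventually_countable_forall.2 h).exists
  exact (wellFounded_iff_isEmpty_descending_chain.1 ZFSet.mem_wf).false ⟨fun n => f n ξ, hξ⟩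

instance small_E (x : U.PreUlt) : Small.{u} {y // U.E y x} := by
  obtain ⟨f, rfl⟩ := Quotient.exists_rep x
  let T : Set.Iio δ.ord → Set ZFSet.{u} := fun ξ => {z | z ∈ insert ∅ (f ξ)}
  have : ∀ ξ, Small.{u} (T ξ) := fun ξ => ZFSet.small_coe (insert ∅ (f ξ))
  have hsub : {y | U.E y (f : U.PreUlt)} ⊆
      Set.range fun g : ∀ ξ, T ξ => ((fun ξ => (g ξ : ZFSet.{u})) : U.PreUlt) := by
    intro y hy
    obtain ⟨g, rfl⟩ := Quotient.exists_rep y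
    classical
    refine ⟨fun ξ => if h : g ξ ∈ f ξ then ⟨g ξ, ZFSet.mem_insert_of_mem _ h⟩
      else ⟨∅, ZFSet.mem_insert _ _⟩, ?_⟩
    refine Filter.Germ.coe_eq.2 ?_
    filter_upwards [show ∀ᶠ ξ in (U.toUltrafilter : Filter _), g ξ ∈ f ξ from hy] with ξ hξ
    simp [hξ]
  exact small_subset hsub

/-- The transitive collapse of the ultrapower: `collapse [f] = {collapse [g] | [g] E [f]}`. -/
noncomputable def collapse : U.PreUlt → ZFSet.{u} :=
  U.wellFounded_E.fix fun x ih => ZFSet.range fun y : {y // U.E y x} => ih y.1 y.2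

theorem mem_collapse {x : U.PreUlt} {z : ZFSet.{u}} :
    z ∈ U.collapse x ↔ ∃ y, U.E y x ∧ U.collapse y = z := by
  rw [collapse, WellFounded.fix_eq, ZFSet.mem_range]
  simp

/-- `Ult(V, U)`, as a class of sets. -/
def Ult : Set ZFSet.{u} :=
  Set.range U.collapse

/-- The ultrapower embedding `j_U : V → Ult(V, U)`, sending `x` to the collapse of the class of the
constant function with value `x`. -/
noncomputable def j (x : ZFSet.{u}) : ZFSet.{u} :=
  U.collapse ((fun _ => x : Set.Iio δ.ord → ZFSet.{u}) : U.PreUlt)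

end NormalUltrafilter

/-! ### Freshness -/

/-- The ordinals that belong to the set `A`. -/
def ordinalsIn (A : ZFSet.{u}) : Set Ordinal.{u} :=
  {α | α.toZFSet ∈ A}

theorem bddAbove_ordinalsIn (A : ZFSet.{u}) : BddAbove (ordinalsIn A) :=
  ⟨A.rank, fun α (hα : α.toZFSet ∈ A) => by simpa using (ZFSet.rank_lt_of_mem hα).le⟩

/-- `A` is a set of ordinals that is fresh over the class `M`: `A ∉ M`, and `A ∩ α ∈ M` for all
`α < lub(A)`. -/
structure IsFresh (M : Set ZFSet.{u}) (A : ZFSet.{u}) : Prop where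
  isOrdinal : ∀ x ∈ A, x.IsOrdinal
  notMem : A ∉ M
  inter_mem : ∀ α < sSup (ordinalsIn A), A ∩ α.toZFSet ∈ M

/-! The square sequence is converted into tree orders `T_i` on `κ`, for `i < δ`, such that any `α <
β` are `T_i`-comparable for `U`-almost all `i`, while no `T_i` has a cofinal branch
(`exists_coherent_matrix`). Almost all rows cohere, so the classes of `i ↦ P i β` for `β < κ`
end-extend one another in the ultrapower. Since `κ > δ` is regular, `j_U` is cofinal in `j_U(κ)`,
and their union is a subset of `j_U(κ)` with all proper initial segments in `Ult(V, U)`. Coding it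
on successor ordinals and adding all limits makes it club. If it were represented by some `f`, a
pigeonhole over `δ < κ` indices would make a single `f i` code a cofinal branch of `T_i`
(`exists_fresh_club`).

The trees come from walking along `C β`. A colour `col β < δ` is needed that is constant along the
limit points of each `C β` and takes every value stationarily often; the first element of `C β`
above a suitable `ν` provides it, since otherwise a thread would exist
(`exists_firstAbove_stationary`). Points `β` of colour `i` get no `T_i`-predecessors. The
predecessor sets are closed, so a cofinal branch of `T_i` would pass through such a point, which is
absurd. -/

/-! ### Regular cardinals, limit points and clubs. -/

theorem exists_forall_le_of_isRegular {κ : Cardinal.{u}} (hκ : κ.IsRegular) {ι : Type (u + 1)}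
    (hι : #ι < Cardinal.lift.{u + 1} κ) {f : ι → Ordinal.{u}} (hf : ∀ i, f i < κ.ord) :
    ∃ γ < κ.ord, ∀ i, f i ≤ γ := by
  refine ⟨sSup (Set.range f), Ordinal.sSup_lt_of_lt_cof ?_ (by simpa using hf), fun i => ?_⟩
  · rw [← Ordinal.lift_cof, hκ.cof_ord]
    exact mk_range_le.trans_lt hι
  · exact le_csSup ⟨κ.ord, by rintro _ ⟨i, rfl⟩; exact (hf i).le⟩ ⟨i, rfl⟩

theorem mk_Iio_lt_lift {κ : Cardinal.{u}} {α : Ordinal.{u}} (hα : α < κ.ord) :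
    #(Set.Iio α) < Cardinal.lift.{u + 1} κ := by
  rw [Cardinal.mk_Iio_ordinal, Cardinal.lift_lt]
  exact Cardinal.lt_ord.1 hα

theorem exists_limit_closed {κ : Cardinal.{u}} (hκ : κ.IsRegular) (hω : ℵ₀ < κ)
    {G : Ordinal.{u} → Ordinal.{u}} (hG : ∀ α < κ.ord, α < G α ∧ G α < κ.ord)
    {α : Ordinal.{u}} (hα : α < κ.ord) :
    ∃ β < κ.ord, α < β ∧ ∀ γ < β, ∃ ξ, γ < ξ ∧ ξ < G ξ ∧ G ξ < β := by
  have hn : ∀ n : ℕ, G^[n] α < κ.ord := by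
    intro n
    induction n with
    | zero => exact hα
    | succ n ih => rw [Function.iterate_succ_apply']; exact (hG _ ih).2
  have hs : ∀ n : ℕ, G^[n] α < G^[n + 1] α := fun n => by
    rw [Function.iterate_succ_apply']; exact (hG _ (hn n)).1
  have hlt : ∀ n : ℕ, G^[n] α < Ordinal.nfp G α := fun n =>
    (hs n).trans_le (Ordinal.iterate_le_nfp G α (n + 1))
  refine ⟨Ordinal.nfp G α, Ordinal.nfp_lt_ord (by rwa [hκ.cof_ord]) (fun i hi => (hG i hi).2) hα,
    hlt 0, fun γ hγ => ?_⟩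
  obtain ⟨n, hn'⟩ := Ordinal.lt_nfp_iff.1 hγ
  refine ⟨G^[n] α, hn', (hG _ (hn n)).1, ?_⟩
  rw [← Function.iterate_succ_apply' G]
  exact hlt _

theorem IsLimitPoint.isSuccLimit {C : Set Ordinal.{u}} {β : Ordinal.{u}} (h : IsLimitPoint C β) :
    Order.IsSuccLimit β := by
  refine Ordinal.isSuccLimit_iff.2 ⟨h.1, Order.isSuccPrelimit_of_succ_lt fun α hα => ?_⟩
  obtain ⟨γ, -, h1, h2⟩ := h.2 α hα
  exact (Order.succ_le_of_lt h1).trans_lt h2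

theorem IsLimitPoint.congr {C D : Set Ordinal.{u}} {β : Ordinal.{u}} (h : IsLimitPoint C β)
    (hCD : ∀ γ < β, γ ∈ C → γ ∈ D) : IsLimitPoint D β :=
  ⟨h.1, fun α hα => let ⟨γ, h1, h2, h3⟩ := h.2 α hα; ⟨γ, hCD γ h3 h1, h2, h3⟩⟩

/-- Limit points of the set of limit points are limit points. -/
theorem IsLimitPoint.of_forall {C : Set Ordinal.{u}} {β : Ordinal.{u}}
    (h : IsLimitPoint {γ | IsLimitPoint C γ} β) : IsLimitPoint C β := by
  refine ⟨h.1, fun α hα => ?_⟩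
  obtain ⟨γ, h1, h2, h3⟩ := h.2 α hα
  obtain ⟨ξ, h4, h5, h6⟩ := h1.2 α h2
  exact ⟨ξ, h4, h5, h6.trans h3⟩

theorem lt_ord_add_one {κ : Cardinal.{u}} (hκ : κ.IsRegular) {α : Ordinal.{u}} (hα : α < κ.ord) :
    α + 1 < κ.ord :=
  (Cardinal.isSuccLimit_ord hκ.aleph0_le).add_one_lt hα

/-- The set of limit points of an unbounded subset of a regular uncountable cardinal is club. -/
theorem isClubIn_limitPoints {κ : Cardinal.{u}} (hκ : κ.IsRegular) (hω : ℵ₀ < κ)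
    {X : Set Ordinal.{u}} (hX : ∀ α < κ.ord, ∃ β ∈ X, α < β ∧ β < κ.ord) :
    IsClubIn κ.ord {β | β < κ.ord ∧ IsLimitPoint X β} where
  subset := fun β hβ => hβ.1
  closed := fun β hβ h => ⟨hβ, IsLimitPoint.of_forall (h.congr fun γ _ hγ => hγ.2)⟩
  unbounded := by
    intro α hα
    choose! s hs using hX
    obtain ⟨β, hβ, hαβ, h⟩ := exists_limit_closed hκ hω (fun α hα => (hs α hα).2) hα
    refine ⟨β, ⟨hβ, (bot_le.trans_lt hαβ).ne', fun γ hγ => ?_⟩, hαβ⟩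
    obtain ⟨ξ, h1, h2, h3⟩ := h γ hγ
    exact ⟨s ξ, (hs ξ ((h2.trans h3).trans hβ)).1, h1.trans h2, h3⟩

/-- The first element of `C β` above `ν`. -/
noncomputable def firstAbove (C : Ordinal.{u} → Set Ordinal.{u}) (ν β : Ordinal.{u}) :
    Ordinal.{u} :=
  sInf (C β ∩ Set.Ioi ν)

/-! ### Stationary sets from the absence of a thread. -/

namespace IsSquareSequence

variable {κ : Cardinal.{u}} {C : Ordinal.{u} → Set Ordinal.{u}}

theorem firstAbove_mem (hC : IsSquareSequence κ C) {ν β : Ordinal.{u}} (hβ : β < κ.ord)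
    (hl : Order.IsSuccLimit β) (hν : ν < β) : firstAbove C ν β ∈ C β ∩ Set.Ioi ν := by
  obtain ⟨γ, h1, h2⟩ := (hC.club β hβ hl).unbounded ν hν
  exact csInf_mem ⟨γ, h1, h2⟩

/-- Coherence makes `C γ` an initial segment of `C β`. This is what keeps the colouring constant
along limit points. -/
theorem firstAbove_eq (hC : IsSquareSequence κ C) {ν β γ : Ordinal.{u}} (hβ : β < κ.ord)
    (hl : Order.IsSuccLimit β) (hγβ : γ < β) (hγ : IsLimitPoint (C β) γ) (hν : ν < γ) :
    firstAbove C ν γ = firstAbove C ν β := by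
  have h1 := hC.firstAbove_mem (hγβ.trans hβ) hγ.isSuccLimit hν
  have h2 := hC.firstAbove_mem hβ hl (hν.trans hγβ)
  have h0 := hC.coherent β hβ hl γ hγβ hγ
  have h3 : firstAbove C ν β ≤ firstAbove C ν γ := by
    rw [h0] at h1
    exact csInf_le' ⟨h1.1.1, h1.2⟩
  have hlt := (hC.club γ (hγβ.trans hβ) hγ.isSuccLimit).subset h1.1
  refine le_antisymm (csInf_le' ⟨?_, h2.2⟩) h3
  rw [h0]
  exact ⟨h2.1, h3.trans_lt hlt⟩

/-- A cofinal set of pairwise coherent values threads the sequence. -/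
theorem false_of_coherent_unbounded (hC : IsSquareSequence κ C) {E : Set Ordinal.{u}}
    (hE : ∀ β ∈ E, β < κ.ord ∧ Order.IsSuccLimit β) (hu : ∀ α < κ.ord, ∃ β ∈ E, α < β)
    (hcoh : ∀ β ∈ E, ∀ η ∈ E, β < η → IsLimitPoint (C η) β) : False := by
  have hsub : ∀ β ∈ E, C β ⊆ Set.Iio β := fun β hβ => (hC.club β (hE β hβ).1 (hE β hβ).2).subset
  have hT : ∀ η ∈ E, ∀ α < η, (α ∈ ⋃ β ∈ E, C β) ↔ α ∈ C η := by
    intro η hη α hα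
    simp only [Set.mem_iUnion, exists_prop]
    refine ⟨fun ⟨β, hβ, h⟩ => ?_, fun h => ⟨η, hη, h⟩⟩
    rcases lt_trichotomy β η with h1 | rfl | h1
    · rw [hC.coherent η (hE η hη).1 (hE η hη).2 β h1 (hcoh β hβ η hη h1)] at h
      exact h.1
    · exact h
    · rw [hC.coherent β (hE β hβ).1 (hE β hβ).2 η h1 (hcoh η hη β hβ h1)]
      exact ⟨h, hα⟩
  refine hC.no_thread ⟨⋃ β ∈ E, C β, ⟨?_, ?_, ?_⟩, ?_⟩
  · intro α hα
    simp only [Set.mem_iUnion, exists_prop] at hα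
    obtain ⟨β, hβ, h⟩ := hα
    exact (hsub β hβ h).trans (hE β hβ).1
  · intro β hβ h
    obtain ⟨η, hη, hlt⟩ := hu β hβ
    rw [hT η hη β hlt]
    exact (hC.club η (hE η hη).1 (hE η hη).2).closed β hlt
      (h.congr fun γ hγ => (hT η hη γ (hγ.trans hlt)).1)
  · intro α hα
    obtain ⟨η, hη, hlt⟩ := hu α hα
    obtain ⟨γ, h1, h2⟩ := (hC.club η (hE η hη).1 (hE η hη).2).unbounded α hlt
    exact ⟨γ, (hT η hη γ (hsub η hη h1)).2 h1, h2⟩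
  · intro β hβ h
    obtain ⟨η, hη, hlt⟩ := hu β hβ
    rw [hC.coherent η (hE η hη).1 (hE η hη).2 β hlt
      (h.congr fun γ hγ => (hT η hη γ (hγ.trans hlt)).1)]
    ext α
    exact and_congr_left fun hα => hT η hη α (lt_trans hα hlt)

/-- For some `ν`, the first element of `C β` above `ν` takes unboundedly many values on stationary
sets. -/
theorem exists_firstAbove_stationary (hC : IsSquareSequence κ C) :
    ∃ ν < κ.ord, ∀ e < κ.ord, ∃ x, e < x ∧ x < κ.ord ∧ ∀ D, IsClubIn κ.ord D →
      ∃ β ∈ D, Order.IsSuccLimit β ∧ ν < β ∧ firstAbove C ν β = x := by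
  have hκ := hC.regular
  by_contra! hcon
  choose! e he D hD hDg using hcon
  -- The failure gives bounds `e ν` and clubs `D ν x` for `x > e ν`, where `D ν x` avoids the points
  -- with first element `x`. Ordinals closed under the step function are closed under `e` and lie in
  -- the diagonal intersection of the `D ν x`.
  have step : ∀ α < κ.ord, ∃ ξ, α < ξ ∧ ξ < κ.ord ∧ ∀ ν < α, e ν < ξ ∧
      ∀ x < α, e ν < x → ∃ d ∈ D ν x, α < d ∧ d < ξ := by
    intro α hα
    have hd : ∀ ν < α, ∀ x < α, e ν < x → ∃ d ∈ D ν x, α < d := fun ν hν x hx hex =>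
      (hD ν (hν.trans hα) x hex (hx.trans hα)).unbounded α hα
    choose! d hd hαd using hd
    have hmk := mk_Iio_lt_lift hα
    obtain ⟨γ₁, hγ₁, h1⟩ := exists_forall_le_of_isRegular hκ hmk
      (f := fun ν => e ν) (fun ν => he ν (lt_trans ν.2 hα))
    obtain ⟨γ₂, hγ₂, h2⟩ := exists_forall_le_of_isRegular hκ
      (ι := Set.Iio α × Set.Iio α) (by
        simp only [mk_prod, Cardinal.lift_id]
        exact mul_lt_of_lt (by simpa using hκ.aleph0_le) hmk hmk)
      (f := fun p => if e p.1 < p.2 then d p.1 p.2 else 0) (by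
        intro p
        split_ifs with h
        · exact (hD _ (lt_trans p.1.2 hα) _ h (lt_trans p.2.2 hα)).subset (hd _ p.1.2 _ p.2.2 h)
        · exact hκ.ord_pos)
    refine ⟨max α (max γ₁ γ₂) + 1, by simp [← Order.succ_eq_add_one],
      lt_ord_add_one hκ (by simp [hα, hγ₁, hγ₂]), fun ν hν => ⟨?_, fun x hx hex =>
      ⟨d ν x, hd ν hν x hx hex, hαd ν hν x hx hex, ?_⟩⟩⟩
    · have := h1 ⟨ν, hν⟩
      rw [← Order.succ_eq_add_one, Order.lt_succ_iff]
      exact this.trans (by simp)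
    · have := h2 (⟨ν, hν⟩, ⟨x, hx⟩)
      simp only [hex, if_true] at this
      rw [← Order.succ_eq_add_one, Order.lt_succ_iff]
      exact this.trans (by simp)
  choose! G hG1 hG2 hG3 using step
  let E : Set Ordinal.{u} := {β | β < κ.ord ∧ Order.IsSuccLimit β ∧ ∀ ν < β, e ν < β ∧
    ∀ x < β, e ν < x → β ∈ D ν x}
  refine hC.false_of_coherent_unbounded (E := E) (fun β hβ => ⟨hβ.1, hβ.2.1⟩) ?_ ?_
  · intro α hα
    obtain ⟨β, hβ, hαβ, h⟩ := exists_limit_closed hκ hC.uncountable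
      (fun α hα => ⟨hG1 α hα, hG2 α hα⟩) hα
    have hne : β ≠ 0 := (bot_le.trans_lt hαβ).ne'
    refine ⟨β, ⟨hβ, IsLimitPoint.isSuccLimit (C := Set.univ) ⟨hne, fun γ hγ => ?_⟩,
      fun ν hν => ⟨?_, fun x hx hex => ?_⟩⟩, hαβ⟩
    · obtain ⟨ξ, h1, h2, h3⟩ := h γ hγ
      exact ⟨ξ, trivial, h1, h2.trans h3⟩
    · obtain ⟨ξ, h1, h2, h3⟩ := h ν hν
      exact (hG3 ξ ((h2.trans h3).trans hβ) ν h1).1.trans h3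
    · refine (hD ν (hν.trans hβ) x hex (hx.trans hβ)).closed β hβ ⟨hne, fun γ hγ => ?_⟩
      obtain ⟨ξ, h1, h2, h3⟩ := h (max γ (max ν x)) (by simp [hγ, hν, hx])
      simp only [max_lt_iff] at h1
      obtain ⟨d, hd, h4, h5⟩ := (hG3 ξ ((h2.trans h3).trans hβ) ν h1.2.1).2 x h1.2.2 hex
      exact ⟨d, hd, h1.1.trans h4, h5.trans h3⟩
  · intro β hβ η hη hlt
    refine ⟨hβ.2.1.ne_bot, fun ν hν => ?_⟩
    have hmem := hC.firstAbove_mem hη.1 hη.2.1 (hν.trans hlt)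
    have hlt' := (hC.club η hη.1 hη.2.1).subset hmem.1
    refine ⟨_, hmem.1, hmem.2, lt_of_le_of_lt ?_ (hβ.2.2 ν hν).1⟩
    -- A first element `x` of `C η` above `ν` with `e ν < x` is impossible, as `η ∈ D ν x`. Hence it
    -- is at most `e ν < β`, so `C η` is unbounded in `β`.
    by_contra! hgt
    exact hDg ν (hν.trans hβ.1) _ hgt (hlt'.trans hη.1) η
      ((hη.2.2 ν (hν.trans hlt)).2 _ hlt' hgt) hη.2.1 (hν.trans hlt) rfl

end IsSquareSequence

-- The tree orders and their coherence.

universe v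

section Matrix

variable {I : Type v} (C : Ordinal.{u} → Set Ordinal.{u}) (ν : Ordinal.{u})
  (col : Ordinal.{u} → I) (i : I)

/-- The limit points of `C β` between `ν` and `β`. -/
def limitsAbove (β : Ordinal.{u}) : Set Ordinal.{u} :=
  {γ | γ < β ∧ IsLimitPoint (C β) γ ∧ ν < γ}

/-- The part of `C β` above `ν` and from the last limit point of `C β` on. -/
def topPart (β : Ordinal.{u}) : Set Ordinal.{u} :=
  {γ | γ ∈ C β ∧ ν < γ ∧ ∀ ξ ∈ limitsAbove C ν β, ξ ≤ γ}

/-- The predecessors of `β` in the `i`-th of a family of tree orders on the ordinals. Along the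
limit points of `C β` the predecessors of `β` are those of the limit points, except that `β` has no
predecessors at all for `i = col β`. -/
def treePred (β : Ordinal.{u}) : Set Ordinal.{u} :=
  {α | α < β ∧ (β ≤ ν ∨ ∃ γ, ∃ _ : γ < β, (α = γ ∨ α ∈ treePred γ) ∧
    (β = γ + 1 ∨ ν < β ∧ Order.IsSuccLimit β ∧ i ≠ col β ∧
      (γ ∈ limitsAbove C ν β ∨ γ ∈ topPart C ν β ∧
        ∀ ξ ∈ topPart C ν β, ∀ η, ∀ _ : η < β, η ∈ topPart C ν β → ξ < η → ξ ∈ treePred η)))}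
termination_by β
decreasing_by all_goals assumption

/-- The ordinals whose predecessors make up the predecessors of the limit ordinal `β`. -/
def treeSteps (β : Ordinal.{u}) : Set Ordinal.{u} :=
  {γ | γ ∈ limitsAbove C ν β ∨ γ ∈ topPart C ν β ∧
    ∀ ξ ∈ topPart C ν β, ∀ η ∈ topPart C ν β, ξ < η → ξ ∈ treePred C ν col i η}

variable {C ν col i}

theorem treePred_subset (β : Ordinal.{u}) : treePred C ν col i β ⊆ Set.Iio β := by
  intro α hα
  rw [treePred] at hα
  exact hα.1

theorem treePred_of_le {β : Ordinal.{u}} (h : β ≤ ν) : treePred C ν col i β = Set.Iio β := by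
  ext α
  rw [treePred]
  simp [h]

theorem mem_treePred_add_one {α β : Ordinal.{u}} :
    α ∈ treePred C ν col i (β + 1) ↔ α = β ∨ α ∈ treePred C ν col i β := by
  have hlt : β < β + 1 := by simp
  by_cases h : β + 1 ≤ ν
  · rw [treePred_of_le h, treePred_of_le (hlt.le.trans h), Set.mem_Iio, Set.mem_Iio,
      ← Order.succ_eq_add_one, Order.lt_succ_iff, le_iff_eq_or_lt]
  · rw [treePred]
    constructor
    · rintro ⟨-, h1 | ⟨γ, hγ, h1, h2 | ⟨-, h2, -⟩⟩⟩
      · exact absurd h1 h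
      · rw [← Order.succ_eq_add_one, ← Order.succ_eq_add_one, Order.succ_eq_succ_iff] at h2
        rwa [h2]
      · exact absurd h2.isSuccPrelimit (by
          rw [← Order.succ_eq_add_one]; exact Order.not_isSuccPrelimit_succ β)
    · intro h1
      refine ⟨?_, Or.inr ⟨β, hlt, h1, Or.inl rfl⟩⟩
      rcases h1 with rfl | h1
      · exact hlt
      · exact lt_trans (treePred_subset _ h1) hlt

namespace IsSquareSequence

variable {κ : Cardinal.{u}} (hC : IsSquareSequence κ C) {α β γ : Ordinal.{u}}
include hC

theorem limitsAbove_subset (hβ : β < κ.ord) (hl : Order.IsSuccLimit β) :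
    limitsAbove C ν β ⊆ C β :=
  fun _ h => (hC.club β hβ hl).closed _ h.1 h.2.1

theorem treeSteps_subset (hβ : β < κ.ord) (hl : Order.IsSuccLimit β) :
    treeSteps C ν col i β ⊆ C β ∩ Set.Ioi ν := by
  rintro γ (h | h)
  · exact ⟨hC.limitsAbove_subset hβ hl h, h.2.2⟩
  · exact ⟨h.1.1, h.1.2.1⟩

theorem mem_treePred_limit (hβ : β < κ.ord) (hl : Order.IsSuccLimit β) (hν : ν < β) :
    α ∈ treePred C ν col i β ↔
      i ≠ col β ∧ ∃ γ ∈ treeSteps C ν col i β, α = γ ∨ α ∈ treePred C ν col i γ := by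
  have hsub := (hC.club β hβ hl).subset
  rw [treePred]
  constructor
  · rintro ⟨-, h1 | ⟨γ, hγ, h1, h2 | ⟨-, -, h2, h3⟩⟩⟩
    · exact absurd h1 hν.not_ge
    · refine absurd hl.isSuccPrelimit ?_
      rw [h2, ← Order.succ_eq_add_one]
      exact Order.not_isSuccPrelimit_succ γ
    · exact ⟨h2, γ, h3.imp_right fun h => ⟨h.1, fun ξ hξ η hη => h.2 ξ hξ η (hsub hη.1) hη⟩, h1⟩
  · rintro ⟨h2, γ, h3, h1⟩
    have hγ := hsub (hC.treeSteps_subset hβ hl h3).1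
    refine ⟨?_, Or.inr ⟨γ, hγ, h1, Or.inr ⟨hν, hl, h2,
      h3.imp_right fun h => ⟨h.1, fun ξ hξ η _ hη => h.2 ξ hξ η hη⟩⟩⟩⟩
    rcases h1 with rfl | h1
    · exact hγ
    · exact lt_trans (treePred_subset _ h1) hγ

theorem limitsAbove_eq (hβ : β < κ.ord) (hl : Order.IsSuccLimit β)
    (hγ : γ ∈ limitsAbove C ν β) : limitsAbove C ν γ = limitsAbove C ν β ∩ Set.Iio γ := by
  have h := hC.coherent β hβ hl γ hγ.1 hγ.2.1
  ext ξ
  constructor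
  · rintro ⟨h1, h2, h3⟩
    exact ⟨⟨h1.trans hγ.1, h2.congr fun η _ hη => by rw [h] at hη; exact hη.1, h3⟩, h1⟩
  · rintro ⟨⟨h1, h2, h3⟩, h4⟩
    exact ⟨h4, h2.congr fun η hη h5 => by rw [h]; exact ⟨h5, hη.trans h4⟩, h3⟩

/-- If the limit points of `C β` are bounded by an element of `C β`, there is a last one. -/
theorem exists_max_limitsAbove (hβ : β < κ.ord) (hl : Order.IsSuccLimit β)
    (hγ : γ ∈ topPart C ν β) (hα : α ∈ limitsAbove C ν β) :
    ∃ ξ ∈ limitsAbove C ν β ∩ topPart C ν β, α ≤ ξ := by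
  have hbdd : BddAbove (limitsAbove C ν β) := ⟨γ, hγ.2.2⟩
  have hle : ∀ ξ ∈ limitsAbove C ν β, ξ ≤ sSup (limitsAbove C ν β) := fun ξ hξ => le_csSup hbdd hξ
  -- A supremum that is not attained is a limit of points of `C β`, hence itself one of the limit
  -- points.
  have hmem : sSup (limitsAbove C ν β) ∈ limitsAbove C ν β := by
    by_contra hn
    refine hn ⟨(csSup_le ⟨α, hα⟩ hγ.2.2).trans_lt ((hC.club β hβ hl).subset hγ.1), ?_,
      hα.2.2.trans_le (hle α hα)⟩
    refine ⟨((bot_le.trans_lt hα.2.2).trans_le (hle α hα)).ne', fun η hη => ?_⟩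
    obtain ⟨ξ, h1, h2⟩ := exists_lt_of_lt_csSup ⟨α, hα⟩ hη
    refine ⟨ξ, hC.limitsAbove_subset hβ hl h1, h2, (hle ξ h1).lt_of_ne fun h => hn (h ▸ h1)⟩
  exact ⟨_, ⟨hmem, hC.limitsAbove_subset hβ hl hmem, hmem.2.2, hle⟩, hle α hα⟩

/-- By induction on `β`. At a limit, the steps form a chain: limit points of `C β` share its colour,
the top part is used only if it is a chain, and the last limit point lies in the top part and links
the two. -/
theorem treePred_eq (hcol : ∀ β < κ.ord, Order.IsSuccLimit β → ∀ γ ∈ limitsAbove C ν β,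
      col γ = col β) (hβ : β < κ.ord) (hα : α ∈ treePred C ν col i β) :
    treePred C ν col i α = treePred C ν col i β ∩ Set.Iio α := by
  induction β using WellFoundedLT.induction generalizing α with
  | ind β ih =>
  rcases le_or_gt β ν with hν | hν
  · have h := treePred_subset _ hα
    rw [treePred_of_le hν, treePred_of_le (le_trans (le_of_lt h) hν),
      Set.inter_eq_right.2 (Set.Iio_subset_Iio (le_of_lt h))]
  rcases Ordinal.zero_or_succ_or_isSuccLimit β with rfl | ⟨γ, rfl⟩ | hl
  · exact absurd hν not_lt_bot
  · simp only [Order.succ_eq_add_one] at *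
    have hlt : γ < γ + 1 := by simp
    rw [mem_treePred_add_one] at hα
    ext ξ
    simp only [Set.mem_inter_iff, mem_treePred_add_one, Set.mem_Iio]
    rcases hα with rfl | hα
    · constructor
      · exact fun h => ⟨Or.inr h, treePred_subset _ h⟩
      · rintro ⟨rfl | h, h'⟩
        · exact absurd h' (lt_irrefl _)
        · exact h
    · rw [ih γ hlt (hlt.trans hβ) hα]
      refine and_congr_left fun h => (or_iff_right ?_).symm
      rintro rfl
      exact lt_asymm (show ξ < α from h) (treePred_subset _ hα)
  have hsub : treeSteps C ν col i β ⊆ Set.Iio β := fun γ hγ =>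
    (hC.club β hβ hl).subset (hC.treeSteps_subset hβ hl hγ).1
  have hlim : i ≠ col β → ∀ γ ∈ limitsAbove C ν β, ∀ γ' ∈ limitsAbove C ν β, γ < γ' →
      γ ∈ treePred C ν col i γ' := by
    intro hi γ hγ γ' hγ' hlt
    rw [hC.mem_treePred_limit (hγ'.1.trans hβ) hγ'.2.1.isSuccLimit hγ'.2.2, hcol β hβ hl γ' hγ']
    exact ⟨hi, γ, Or.inl (by rw [hC.limitsAbove_eq hβ hl hγ']; exact ⟨hγ, hlt⟩), Or.inl rfl⟩
  have hsteps : i ≠ col β → ∀ γ ∈ treeSteps C ν col i β, ∀ γ' ∈ treeSteps C ν col i β, γ < γ' →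
      γ ∈ treePred C ν col i γ' := by
    rintro hi γ hγ γ' (hγ' | ⟨hγ', hchain⟩) hlt
    · rcases hγ with hγ | ⟨hγ, -⟩
      · exact hlim hi γ hγ γ' hγ' hlt
      · exact absurd hlt (hγ.2.2 γ' hγ').not_gt
    · rcases hγ with hγ | ⟨hγ, -⟩
      · obtain ⟨ξ, hξ, hle⟩ := hC.exists_max_limitsAbove hβ hl hγ' hγ
        rcases (hγ'.2.2 ξ hξ.1).eq_or_lt with rfl | hlt'
        · exact hlim hi γ hγ _ hξ.1 hlt
        have h1 := hchain ξ hξ.2 γ' hγ' hlt'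
        rcases hle.eq_or_lt with rfl | hlt''
        · exact h1
        have h2 := hlim hi γ hγ ξ hξ.1 hlt''
        have hγβ := (hC.club β hβ hl).subset hγ'.1
        rw [ih γ' hγβ (lt_trans hγβ hβ) h1] at h2
        exact h2.1
      · exact hchain γ hγ γ' hγ' hlt
  obtain ⟨hi, γ, hγ, h⟩ := (hC.mem_treePred_limit hβ hl hν).1 hα
  have key : ∀ γ ∈ treeSteps C ν col i β,
      treePred C ν col i γ = treePred C ν col i β ∩ Set.Iio γ := by
    intro γ hγ
    ext ξ
    constructor
    · exact fun h => ⟨(hC.mem_treePred_limit hβ hl hν).2 ⟨hi, γ, hγ, Or.inr h⟩,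
        treePred_subset _ h⟩
    · rintro ⟨h1, h2⟩
      obtain ⟨-, γ', hγ', h3⟩ := (hC.mem_treePred_limit hβ hl hν).1 h1
      rcases lt_trichotomy γ γ' with hlt | rfl | hlt
      · have h4 := hsteps hi γ hγ γ' hγ' hlt
        rw [ih γ' (hsub hγ') (lt_trans (hsub hγ') hβ) h4]
        refine ⟨h3.resolve_left ?_, h2⟩
        rintro rfl
        exact lt_asymm (show ξ < γ from h2) hlt
      · exact h3.resolve_left (ne_of_lt h2)
      · have h4 := hsteps hi γ' hγ' γ hγ hlt
        rcases h3 with rfl | h3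
        · exact h4
        · rw [ih γ (hsub hγ) (lt_trans (hsub hγ) hβ) h4] at h3
          exact h3.1
  rcases h with rfl | h
  · exact key α hγ
  · rw [ih γ (hsub hγ) (lt_trans (hsub hγ) hβ) h, key γ hγ, Set.inter_assoc,
      Set.inter_eq_right.2 (Set.Iio_subset_Iio (le_of_lt (treePred_subset _ h)))]

theorem treePred_closed (hcol : ∀ β < κ.ord, Order.IsSuccLimit β → ∀ γ ∈ limitsAbove C ν β,
      col γ = col β) (hβ : β < κ.ord) (hαβ : α < β)
    (hα : IsLimitPoint (treePred C ν col i β) α) : α ∈ treePred C ν col i β := by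
  induction β using WellFoundedLT.induction with
  | ind β ih =>
  rcases le_or_gt β ν with hν | hν
  · rw [treePred_of_le hν]
    exact hαβ
  rcases Ordinal.zero_or_succ_or_isSuccLimit β with rfl | ⟨γ, rfl⟩ | hl
  · exact absurd hν not_lt_bot
  · simp only [Order.succ_eq_add_one] at *
    have hlt : γ < γ + 1 := by simp
    rw [mem_treePred_add_one]
    rw [← Order.succ_eq_add_one, Order.lt_succ_iff] at hαβ
    rcases hαβ.eq_or_lt with rfl | hαγ
    · exact Or.inl rfl
    refine Or.inr (ih γ hlt (hlt.trans hβ) hαγ (hα.congr fun ξ hξ h => ?_))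
    exact (mem_treePred_add_one.1 h).resolve_left (hξ.trans hαγ).ne
  -- If no step reaches `α`, the steps are cofinal in `α`. Then `α` is a limit point of `C β` above
  -- `ν`, hence itself a step.
  by_cases hex : ∃ γ ∈ treeSteps C ν col i β, α ≤ γ
  · obtain ⟨γ, hγ, hle⟩ := hex
    have hi : i ≠ col β := by
      obtain ⟨ξ, h, -⟩ := hα.2 0 hα.1.bot_lt
      exact ((hC.mem_treePred_limit hβ hl hν).1 h).1
    have hγβ : γ ∈ treePred C ν col i β :=
      (hC.mem_treePred_limit hβ hl hν).2 ⟨hi, γ, hγ, Or.inl rfl⟩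
    rcases hle.eq_or_lt with rfl | hlt
    · exact hγβ
    have hlt' := treePred_subset _ hγβ
    have heq := hC.treePred_eq hcol hβ hγβ
    have := ih γ hlt' (lt_trans hlt' hβ) hlt (hα.congr fun ξ hξ h => by
      rw [heq]; exact ⟨h, hξ.trans hlt⟩)
    rw [heq] at this
    exact this.1
  · push Not at hex
    have hlim : IsLimitPoint (treeSteps C ν col i β) α := by
      refine ⟨hα.1, fun ξ hξ => ?_⟩
      obtain ⟨η, h1, h2, h3⟩ := hα.2 ξ hξ
      obtain ⟨-, γ, hγ, h4⟩ := (hC.mem_treePred_limit hβ hl hν).1 h1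
      refine ⟨γ, hγ, ?_, hex γ hγ⟩
      rcases h4 with rfl | h4
      · exact h2
      · exact h2.trans (treePred_subset _ h4)
    have hνα : ν < α := by
      obtain ⟨γ, hγ, -, h⟩ := hlim.2 0 hlim.1.bot_lt
      exact lt_trans (hC.treeSteps_subset hβ hl hγ).2 h
    exact absurd (hex α (Or.inl ⟨hαβ, hlim.congr fun γ _ hγ =>
      (hC.treeSteps_subset hβ hl hγ).1, hνα⟩)) (lt_irrefl _)

/-- The least `σ < β` with infinitely many elements of the top part below it would be a limit point
of `C β`, and no element of the top part lies below one. So proper initial segments are finite, and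
counting predecessors injects the top part into `ℕ`. -/
theorem countable_topPart (hβ : β < κ.ord) (hl : Order.IsSuccLimit β) :
    (topPart C ν β).Countable := by
  have hfin : ∀ γ < β, (topPart C ν β ∩ Set.Iio γ).Finite := by
    by_contra! hinf
    obtain ⟨γ, hγ, hγi⟩ := hinf
    let σ := sInf {σ | (topPart C ν β ∩ Set.Iio σ).Infinite}
    have hσ : (topPart C ν β ∩ Set.Iio σ).Infinite :=
      csInf_mem (s := {σ | (topPart C ν β ∩ Set.Iio σ).Infinite}) ⟨γ, hγi⟩
    have hσβ : σ < β := (csInf_le' hγi).trans_lt hγ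
    have hlt : ∀ α < σ, ∃ ξ ∈ topPart C ν β, α < ξ ∧ ξ < σ := by
      intro α hα
      by_contra! hcon
      have h1 : (topPart C ν β ∩ Set.Iio α).Finite := by
        by_contra h
        exact notMem_of_lt_csInf' hα h
      refine hσ ((h1.union (Set.finite_singleton α)).subset fun ξ hξ => ?_)
      rcases lt_trichotomy ξ α with h | h | h
      · exact Or.inl ⟨hξ.1, h⟩
      · exact Or.inr h
      · exact absurd hξ.2 (hcon ξ hξ.1 h).not_gt
    obtain ⟨ξ, hξ⟩ := hσ.nonempty
    have hmem : σ ∈ limitsAbove C ν β := ⟨hσβ, ⟨(bot_le.trans_lt hξ.2).ne', fun α hα =>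
      let ⟨ξ, h1, h2⟩ := hlt α hα; ⟨ξ, h1.1, h2⟩⟩, hξ.1.2.1.trans hξ.2⟩
    exact absurd hξ.2 (hξ.1.2.2 σ hmem).not_gt
  have hsub : ∀ γ ∈ topPart C ν β, γ < β := fun γ hγ => (hC.club β hβ hl).subset hγ.1
  refine Set.countable_iff_exists_injOn.2
    ⟨fun γ => (topPart C ν β ∩ Set.Iio γ).ncard, StrictMonoOn.injOn fun γ hγ γ' hγ' hlt => ?_⟩
  refine Set.ncard_lt_ncard (Set.ssubset_iff_of_subset
    (Set.inter_subset_inter_right _ (Set.Iio_subset_Iio hlt.le)) |>.2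
    ⟨γ, ⟨hγ, hlt⟩, fun h => lt_irrefl γ h.2⟩) (hfin γ' (hsub γ' hγ'))

/-- Nonprincipality avoids the one bad colour `col β`. Countable completeness makes the countable
top part a chain for almost all `i`. -/
theorem eventually_mem_treePred {l : Filter I} [CountableInterFilter l] (hl : ∀ i, ∀ᶠ j in l, j ≠ i)
    (hβ : β < κ.ord) (hα : α < β) : ∀ᶠ i in l, α ∈ treePred C ν col i β := by
  induction β using WellFoundedLT.induction generalizing α with
  | ind β ih =>
  rcases le_or_gt β ν with hν | hν
  · exact Filter.Eventually.of_forall fun i => by rwa [treePred_of_le hν]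
  rcases Ordinal.zero_or_succ_or_isSuccLimit β with rfl | ⟨γ, rfl⟩ | hlim
  · exact absurd hα not_lt_bot
  · simp only [Order.succ_eq_add_one] at *
    have hlt : γ < γ + 1 := by simp
    simp only [mem_treePred_add_one]
    rw [← Order.succ_eq_add_one, Order.lt_succ_iff] at hα
    rcases hα.eq_or_lt with rfl | h
    · simp
    · filter_upwards [ih γ hlt (hlt.trans hβ) h] with i hi using Or.inr hi
  have hsub := (hC.club β hβ hlim).subset
  by_cases hex : ∃ γ ∈ limitsAbove C ν β, α < γ
  · obtain ⟨γ, hγ, h⟩ := hex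
    filter_upwards [hl (col β), ih γ hγ.1 (hγ.1.trans hβ) h] with i h1 h2
    exact (hC.mem_treePred_limit hβ hlim hν).2 ⟨h1, γ, Or.inl hγ, Or.inr h2⟩
  · push Not at hex
    obtain ⟨γ, hγ, hlt⟩ := (hC.club β hβ hlim).unbounded (max α ν) (max_lt hα hν)
    rw [max_lt_iff] at hlt
    have hγt : γ ∈ topPart C ν β := ⟨hγ, hlt.2, fun ξ hξ => (hex ξ hξ).trans hlt.1.le⟩
    have hchain : ∀ᶠ i in l, ∀ ξ ∈ topPart C ν β, ∀ η ∈ topPart C ν β, ξ < η →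
        ξ ∈ treePred C ν col i η := by
      have hc := hC.countable_topPart (ν := ν) hβ hlim
      refine (eventually_countable_ball hc).2 fun ξ _ => (eventually_countable_ball hc).2
        fun η hη => ?_
      by_cases h : ξ < η
      · filter_upwards [ih η (hsub hη.1) (lt_trans (hsub hη.1) hβ) h] with i hi using fun _ => hi
      · exact Filter.Eventually.of_forall fun i h' => absurd h' h
    filter_upwards [hl (col β), ih γ (hsub hγ) (lt_trans (hsub hγ) hβ) hlt.1, hchain] with i h1 h2 h3
    exact (hC.mem_treePred_limit hβ hlim hν).2 ⟨h1, γ, Or.inr ⟨hγt, h3⟩, Or.inr h2⟩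

theorem no_branch_treePred (hcol : ∀ β < κ.ord, Order.IsSuccLimit β → ∀ γ ∈ limitsAbove C ν β,
      col γ = col β)
    (hstat : ∀ D, IsClubIn κ.ord D → ∃ β ∈ D, Order.IsSuccLimit β ∧ ν < β ∧ col β = i)
    {X : Set Ordinal.{u}} (hX : ∀ α < κ.ord, ∃ β ∈ X, α < β ∧ β < κ.ord)
    (hbr : ∀ α ∈ X, α < κ.ord → treePred C ν col i α = X ∩ Set.Iio α) : False := by
  -- A limit point `β` of the branch with colour `i`: closedness puts it on the branch, so it has
  -- predecessors, but its colour forbids them.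
  obtain ⟨β, ⟨hβ, hlim⟩, hl, hν, hi⟩ := hstat _ (isClubIn_limitPoints hC.regular hC.uncountable hX)
  obtain ⟨η, hη, hlt, hηκ⟩ := hX β hβ
  have h1 : β ∈ treePred C ν col i η := hC.treePred_closed hcol hηκ hlt (hlim.congr fun γ hγ h => by
    rw [hbr η hη hηκ]; exact ⟨h, hγ.trans hlt⟩)
  rw [hbr η hη hηκ] at h1
  obtain ⟨γ, hγ, -, hγβ⟩ := hlim.2 0 hlim.1.bot_lt
  have h2 : γ ∈ treePred C ν col i β := by
    rw [hbr β h1.1 hβ]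
    exact ⟨hγ, hγβ⟩
  exact ((hC.mem_treePred_limit hβ hl hν).1 h2).1 hi.symm

end IsSquareSequence

end Matrix

/-- A square sequence yields a coherent matrix of sets of ordinals, indexed by any set that is
smaller than `κ`, without a cofinal branch along any index. -/
theorem IsSquareSequence.exists_coherent_matrix {κ : Cardinal.{u}}
    {C : Ordinal.{u} → Set Ordinal.{u}} (hC : IsSquareSequence κ C) {I : Type (u + 1)} [Nonempty I]
    (hI : #I < Cardinal.lift.{u + 1} κ) {l : Filter I} [CountableInterFilter l]
    (hl : ∀ i, ∀ᶠ j in l, j ≠ i) :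
    ∃ P : I → Ordinal.{u} → Set Ordinal.{u},
      (∀ i, ∀ β < κ.ord, ∀ α ∈ P i β, P i α = P i β ∩ Set.Iio α) ∧
      (∀ β < κ.ord, ∀ α < β, ∀ᶠ i in l, α ∈ P i β) ∧
      ∀ i X, (∀ α < κ.ord, ∃ β ∈ X, α < β ∧ β < κ.ord) →
        ¬ ∀ α ∈ X, α < κ.ord → P i α = X ∩ Set.Iio α := by
  obtain ⟨ν, -, hst⟩ := hC.exists_firstAbove_stationary
  let S : Set Ordinal.{u} := {x | x < κ.ord ∧ ∀ D, IsClubIn κ.ord D →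
      ∃ β ∈ D, Order.IsSuccLimit β ∧ ν < β ∧ firstAbove C ν β = x}
  -- `S` is unbounded in the regular `κ`, so it has room for one stationary value per index.
  have hS : #I ≤ #S := by
    by_contra! h
    obtain ⟨e, he, hle⟩ := exists_forall_le_of_isRegular hC.regular (h.trans hI)
      (f := fun x : S => (x : Ordinal.{u})) fun x => x.2.1
    obtain ⟨x, hx, hxS⟩ := hst e he
    exact hx.not_ge (hle ⟨x, hxS⟩)
  obtain ⟨φ⟩ := hS
  let H : Ordinal.{u} → I := Function.invFun fun i => (φ i : Ordinal.{u})
  have hH : ∀ i, H (φ i) = i :=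
    Function.leftInverse_invFun (Subtype.val_injective.comp φ.injective)
  let col : Ordinal.{u} → I := fun β => H (firstAbove C ν β)
  have hcol : ∀ β < κ.ord, Order.IsSuccLimit β → ∀ γ ∈ limitsAbove C ν β, col γ = col β :=
    fun β hβ hlim γ hγ => congrArg H (hC.firstAbove_eq hβ hlim hγ.1 hγ.2.1 hγ.2.2)
  refine ⟨fun i => treePred C ν col i, fun i β hβ α hα => hC.treePred_eq hcol hβ hα,
    fun β hβ α hα => hC.eventually_mem_treePred hl hβ hα, fun i X hX hbr =>
    hC.no_branch_treePred hcol (fun D hD => ?_) hX hbr⟩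
  obtain ⟨β, h1, h2, h3, h4⟩ := (φ i).2.2 D hD
  exact ⟨β, h1, h2, h3, by rw [← hH i, ← h4]⟩

/-! ### Łoś-type computations in the collapsed ultrapower. -/

namespace NormalUltrafilter

variable {δ : Cardinal.{u}} (U : NormalUltrafilter δ)

theorem eventually_ne (i : Set.Iio δ.ord) : ∀ᶠ j in (U.toUltrafilter : Filter _), j ≠ i :=
  Ultrafilter.compl_mem_iff_notMem.2 (U.isMeasure.nonprincipal i)

theorem E_ext {x y : U.PreUlt} (h : ∀ z, U.E z x ↔ U.E z y) : x = y := by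
  have aux : ∀ f g : Set.Iio δ.ord → ZFSet.{u},
      (∀ z : U.PreUlt, U.E z (f : U.PreUlt) → U.E z (g : U.PreUlt)) →
      ∀ᶠ ξ in (U.toUltrafilter : Filter _), f ξ ⊆ g ξ := by
    intro f g h
    by_contra hcon
    rw [← Ultrafilter.eventually_not] at hcon
    have hex : ∀ ξ, ∃ z, ¬ f ξ ⊆ g ξ → z ∈ f ξ ∧ z ∉ g ξ := by
      intro ξ
      by_cases hξ : f ξ ⊆ g ξ
      · exact ⟨∅, fun h => absurd hξ h⟩
      · simp only [ZFSet.subset_def, not_forall] at hξ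
        obtain ⟨z, h1, h2⟩ := hξ
        exact ⟨z, fun _ => ⟨h1, h2⟩⟩
    choose k hk using hex
    have h1 : {ξ | k ξ ∈ g ξ} ∈ U.toUltrafilter := (U.E_coe k g).1 (h _ ((U.E_coe k f).2 (by
      filter_upwards [hcon] with ξ hξ using (hk ξ hξ).1)))
    obtain ⟨ξ, h2, h3⟩ := (Filter.Eventually.and (p := fun ξ => k ξ ∈ g ξ) h1 hcon).exists
    exact (hk ξ h3).2 h2
  obtain ⟨f, rfl⟩ := Quotient.exists_rep x
  obtain ⟨g, rfl⟩ := Quotient.exists_rep y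
  refine Filter.Germ.coe_eq.2 ?_
  filter_upwards [aux f g fun z => (h z).1, aux g f fun z => (h z).2] with ξ h1 h2
  exact ZFSet.ext fun z => ⟨fun hz => h1 hz, fun hz => h2 hz⟩

theorem collapse_injective : Function.Injective U.collapse := by
  intro x
  induction x using U.wellFounded_E.induction with
  | _ x ih =>
  intro y hxy
  refine U.E_ext fun z => ⟨fun hz => ?_, fun hz => ?_⟩
  · have h := U.mem_collapse.2 ⟨z, hz, rfl⟩
    rw [hxy] at h
    obtain ⟨w, hw, hwz⟩ := U.mem_collapse.1 h
    rwa [ih z hz hwz.symm]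
  · have h := U.mem_collapse.2 ⟨z, hz, rfl⟩
    rw [← hxy] at h
    obtain ⟨w, hw, hwz⟩ := U.mem_collapse.1 h
    rwa [← ih w hw hwz]

/-- The element of `Ult(V, U)` represented by the function `f`. -/
noncomputable def classOf (f : Set.Iio δ.ord → ZFSet.{u}) : ZFSet.{u} :=
  U.collapse (f : U.PreUlt)

variable {U}

theorem classOf_mem_Ult (f : Set.Iio δ.ord → ZFSet.{u}) : U.classOf f ∈ U.Ult :=
  ⟨_, rfl⟩

theorem exists_classOf_eq {x : ZFSet.{u}} (hx : x ∈ U.Ult) : ∃ f, U.classOf f = x := by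
  obtain ⟨y, rfl⟩ := hx
  obtain ⟨f, rfl⟩ := Quotient.exists_rep y
  exact ⟨f, rfl⟩

theorem classOf_eq_classOf {f g : Set.Iio δ.ord → ZFSet.{u}} :
    U.classOf f = U.classOf g ↔ ∀ᶠ ξ in (U.toUltrafilter : Filter _), f ξ = g ξ :=
  U.collapse_injective.eq_iff.trans Filter.Germ.coe_eq

theorem mem_classOf {z : ZFSet.{u}} {g : Set.Iio δ.ord → ZFSet.{u}} :
    z ∈ U.classOf g ↔
      ∃ f, (∀ᶠ ξ in (U.toUltrafilter : Filter _), f ξ ∈ g ξ) ∧ U.classOf f = z := by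
  rw [classOf, U.mem_collapse]
  constructor
  · rintro ⟨y, hy, rfl⟩
    obtain ⟨f, rfl⟩ := Quotient.exists_rep y
    exact ⟨f, hy, rfl⟩
  · rintro ⟨f, hf, rfl⟩
    exact ⟨(f : U.PreUlt), hf, rfl⟩

theorem classOf_mem_classOf {f g : Set.Iio δ.ord → ZFSet.{u}} :
    U.classOf f ∈ U.classOf g ↔ ∀ᶠ ξ in (U.toUltrafilter : Filter _), f ξ ∈ g ξ := by
  rw [mem_classOf]
  constructor
  · rintro ⟨k, hk, h⟩
    filter_upwards [hk, classOf_eq_classOf.1 h] with ξ h1 h2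
    rwa [← h2]
  · exact fun h => ⟨f, h, rfl⟩

variable (U) in
/-- The ordinal of `Ult(V, U)` represented by the function `b`. -/
noncomputable def ordOf (b : Set.Iio δ.ord → Ordinal.{u}) : Ordinal.{u} :=
  (U.classOf fun ξ => (b ξ).toZFSet).rank

theorem mem_classOf_toZFSet {z : ZFSet.{u}} {b : Set.Iio δ.ord → Ordinal.{u}} :
    z ∈ U.classOf (fun ξ => (b ξ).toZFSet) ↔
      ∃ c : Set.Iio δ.ord → Ordinal.{u}, (∀ᶠ ξ in (U.toUltrafilter : Filter _), c ξ < b ξ) ∧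
        U.classOf (fun ξ => (c ξ).toZFSet) = z := by
  rw [mem_classOf]
  constructor
  · rintro ⟨f, hf, rfl⟩
    have h : ∀ᶠ ξ in (U.toUltrafilter : Filter _),
        (f ξ).rank < b ξ ∧ (f ξ).rank.toZFSet = f ξ := by
      filter_upwards [hf] with ξ hξ
      obtain ⟨a, ha, hfa⟩ := Ordinal.mem_toZFSet_iff.1 hξ
      rw [← hfa, Ordinal.rank_toZFSet]
      exact ⟨ha, rfl⟩
    exact ⟨fun ξ => (f ξ).rank, h.mono fun ξ hξ => hξ.1,
      classOf_eq_classOf.2 (h.mono fun ξ hξ => hξ.2)⟩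
  · rintro ⟨c, hc, rfl⟩
    exact ⟨_, hc.mono fun ξ hξ => Ordinal.toZFSet_mem_toZFSet_iff.2 hξ, rfl⟩

theorem isTransitive_classOf_toZFSet (b : Set.Iio δ.ord → Ordinal.{u}) :
    (U.classOf fun ξ => (b ξ).toZFSet).IsTransitive := by
  intro y hy z hz
  obtain ⟨c, hc, rfl⟩ := mem_classOf_toZFSet.1 hy
  obtain ⟨d, hd, rfl⟩ := mem_classOf_toZFSet.1 hz
  exact mem_classOf_toZFSet.2 ⟨d, by filter_upwards [hc, hd] with ξ h1 h2 using h2.trans h1, rfl⟩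

theorem toZFSet_ordOf (b : Set.Iio δ.ord → Ordinal.{u}) :
    (U.ordOf b).toZFSet = U.classOf fun ξ => (b ξ).toZFSet := by
  refine ZFSet.IsOrdinal.toZFSet_rank_eq (ZFSet.isOrdinal_iff_forall_mem_isTransitive.2
    ⟨isTransitive_classOf_toZFSet b, fun y hy => ?_⟩)
  obtain ⟨c, -, rfl⟩ := mem_classOf_toZFSet.1 hy
  exact isTransitive_classOf_toZFSet c

theorem ordOf_lt_ordOf {b c : Set.Iio δ.ord → Ordinal.{u}} :
    U.ordOf b < U.ordOf c ↔ ∀ᶠ ξ in (U.toUltrafilter : Filter _), b ξ < c ξ := by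
  rw [← Ordinal.toZFSet_mem_toZFSet_iff, toZFSet_ordOf, toZFSet_ordOf, classOf_mem_classOf]
  simp only [Ordinal.toZFSet_mem_toZFSet_iff]

theorem ordOf_eq_ordOf {b c : Set.Iio δ.ord → Ordinal.{u}} :
    U.ordOf b = U.ordOf c ↔ ∀ᶠ ξ in (U.toUltrafilter : Filter _), b ξ = c ξ := by
  rw [← Ordinal.toZFSet_injective.eq_iff, toZFSet_ordOf, toZFSet_ordOf, classOf_eq_classOf]
  simp only [Ordinal.toZFSet_injective.eq_iff]

theorem lt_ordOf {α : Ordinal.{u}} {b : Set.Iio δ.ord → Ordinal.{u}} :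
    α < U.ordOf b ↔ ∃ c, (∀ᶠ ξ in (U.toUltrafilter : Filter _), c ξ < b ξ) ∧ U.ordOf c = α := by
  rw [← Ordinal.toZFSet_mem_toZFSet_iff, toZFSet_ordOf, mem_classOf_toZFSet]
  simp only [← toZFSet_ordOf, Ordinal.toZFSet_injective.eq_iff]

/-- A function into a regular `κ > δ` is bounded, so `j_U` is cofinal in `j_U(κ)`. -/
theorem exists_const_gt {κ : Cardinal.{u}} (hκ : κ.IsRegular) (hδκ : δ < κ)
    {b : Set.Iio δ.ord → Ordinal.{u}}
    (hb : ∀ᶠ ξ in (U.toUltrafilter : Filter _), b ξ < κ.ord) :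
    ∃ γ < κ.ord, ∀ᶠ ξ in (U.toUltrafilter : Filter _), b ξ < γ := by
  classical
  obtain ⟨γ, hγ, h⟩ := exists_forall_le_of_isRegular hκ
    (mk_Iio_lt_lift (Cardinal.ord_lt_ord.2 hδκ))
    (f := fun ξ => if b ξ < κ.ord then b ξ else 0) (by
      intro ξ
      split_ifs with h
      · exact h
      · exact hκ.ord_pos)
  refine ⟨γ + 1, lt_ord_add_one hκ hγ, ?_⟩
  filter_upwards [hb] with ξ hξ
  have := h ξ
  rw [if_pos hξ] at this
  rwa [← Order.succ_eq_add_one, Order.lt_succ_iff]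

end NormalUltrafilter

/-! ### The fresh club. -/

/-- The limit ordinals below `β` (and `0`), together with the successors of the elements of `P`. -/
def limitsWithSuccs (P : Set Ordinal.{u}) (β : Ordinal.{u}) : Set Ordinal.{u} :=
  {α | α < β ∧ (Order.IsSuccPrelimit α ∨ ∃ γ ∈ P, α = γ + 1)}

theorem add_one_mem_limitsWithSuccs {P : Set Ordinal.{u}} {α β : Ordinal.{u}} :
    α + 1 ∈ limitsWithSuccs P β ↔ α + 1 < β ∧ α ∈ P := by
  refine and_congr_right fun _ => ⟨?_, fun h => Or.inr ⟨α, h, rfl⟩⟩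
  rintro (h | ⟨γ, hγ, h⟩)
  · rw [← Order.succ_eq_add_one] at h
    exact absurd h (Order.not_isSuccPrelimit_succ α)
  · rw [← Order.succ_eq_add_one, ← Order.succ_eq_add_one, Order.succ_eq_succ_iff] at h
    rwa [h]

theorem limitsWithSuccs_inter_Iio {P : Set Ordinal.{u}} {α β : Ordinal.{u}} (h : α ≤ β) :
    limitsWithSuccs (P ∩ Set.Iio α) α = limitsWithSuccs P β ∩ Set.Iio α := by
  ext ξ
  constructor
  · rintro ⟨h1, h2⟩
    exact ⟨⟨h1.trans_le h, h2.imp_right fun ⟨γ, h3, h4⟩ => ⟨γ, h3.1, h4⟩⟩, h1⟩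
  · rintro ⟨⟨h1, h2⟩, h3⟩
    refine ⟨h3, h2.imp_right fun ⟨γ, h4, h5⟩ => ⟨γ, ⟨h4, ?_⟩, h5⟩⟩
    exact lt_trans (show γ < ξ by rw [h5]; simp) h3

theorem mem_sep_rank {S : Set Ordinal.{u}} {κ : Ordinal.{u}} {z : ZFSet.{u}} :
    z ∈ ZFSet.sep (fun z => z.rank ∈ S) κ.toZFSet ↔ ∃ α < κ, α ∈ S ∧ α.toZFSet = z := by
  rw [ZFSet.mem_sep, Ordinal.mem_toZFSet_iff]
  constructor
  · rintro ⟨⟨α, h1, rfl⟩, h2⟩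
    rw [Ordinal.rank_toZFSet] at h2
    exact ⟨α, h1, h2, rfl⟩
  · rintro ⟨α, h1, h2, rfl⟩
    rw [Ordinal.rank_toZFSet]
    exact ⟨⟨α, h1, rfl⟩, h2⟩

namespace NormalUltrafilter

variable {δ : Cardinal.{u}} {U : NormalUltrafilter δ}

/-- A coherent matrix without a cofinal branch along any index yields a fresh club. -/
theorem exists_fresh_club {κ : Cardinal.{u}} (hκ : κ.IsRegular) (hδκ : δ < κ)
    {P : Set.Iio δ.ord → Ordinal.{u} → Set Ordinal.{u}}
    (hcoh : ∀ i, ∀ β < κ.ord, ∀ α ∈ P i β, P i α = P i β ∩ Set.Iio α)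
    (hcov : ∀ β < κ.ord, ∀ α < β, ∀ᶠ i in (U.toUltrafilter : Filter _), α ∈ P i β)
    (hbr : ∀ i X, (∀ α < κ.ord, ∃ β ∈ X, α < β ∧ β < κ.ord) →
        ¬ ∀ α ∈ X, α < κ.ord → P i α = X ∩ Set.Iio α) :
    ∃ A : ZFSet.{u}, IsClubIn (U.ordOf fun _ => κ.ord) (ordinalsIn A) ∧ IsFresh U.Ult A := by
  let F : Ordinal.{u} → Set.Iio δ.ord → Set Ordinal.{u} := fun β i => limitsWithSuccs (P i β) β
  have hF : ∀ β < κ.ord, ∀ α ≤ β, ∀ᶠ i in (U.toUltrafilter : Filter _),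
      F α i = F β i ∩ Set.Iio α := by
    intro β hβ α hα
    rcases hα.eq_or_lt with rfl | hlt
    · exact Filter.Eventually.of_forall fun i => (Set.inter_eq_left.2 fun ξ hξ => hξ.1).symm
    · filter_upwards [hcov β hβ α hlt] with i hi
      rw [← limitsWithSuccs_inter_Iio hα, ← hcoh i β hβ α hi]
  let A : ZFSet.{u} := ZFSet.sep (fun z => ∃ β < κ.ord, ∃ b : Set.Iio δ.ord → Ordinal.{u},
    (∀ᶠ i in (U.toUltrafilter : Filter _), b i ∈ F β i) ∧ (U.ordOf b).toZFSet = z)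
    (U.ordOf fun _ => κ.ord).toZFSet
  -- By coherence, membership in `A` may be tested at any `β` bounding the representative.
  have hA : ∀ β < κ.ord, ∀ b : Set.Iio δ.ord → Ordinal.{u},
      (∀ᶠ i in (U.toUltrafilter : Filter _), b i < β) →
      ((U.ordOf b).toZFSet ∈ A ↔ ∀ᶠ i in (U.toUltrafilter : Filter _), b i ∈ F β i) := by
    intro β hβ b hb
    rw [ZFSet.mem_sep, Ordinal.toZFSet_mem_toZFSet_iff, ordOf_lt_ordOf]
    constructor
    · rintro ⟨-, β', hβ', b', hb', hbb⟩
      rw [Ordinal.toZFSet_injective.eq_iff, ordOf_eq_ordOf] at hbb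
      rcases le_total β β' with hle | hle
      · filter_upwards [hb, hb', hbb, hF β' hβ' β hle] with i h1 h2 h3 h4
        rw [h4, ← h3]
        exact ⟨h2, by rwa [h3]⟩
      · filter_upwards [hb', hbb, hF β hβ β' hle] with i h2 h3 h4
        rw [h4, h3] at h2
        exact h2.1
    · exact fun h => ⟨hb.mono fun i hi => hi.trans hβ, β, hβ, b, h, rfl⟩
  have hsub : ordinalsIn A ⊆ Set.Iio (U.ordOf fun _ => κ.ord) := fun α hα =>
    Ordinal.toZFSet_mem_toZFSet_iff.1 (ZFSet.mem_sep.1 (show α.toZFSet ∈ A from hα)).1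
  have hrep : ∀ α < U.ordOf fun _ => κ.ord, ∃ c, U.ordOf c = α ∧ ∃ β < κ.ord,
      ∀ᶠ i in (U.toUltrafilter : Filter _), c i < β := by
    intro α hα
    obtain ⟨c, hc, rfl⟩ := lt_ordOf.1 hα
    exact ⟨c, rfl, exists_const_gt hκ hδκ hc⟩
  refine ⟨A, ⟨hsub, ?_, ?_⟩, ?_, ?_, ?_⟩
  · intro α hα hlim
    obtain ⟨c, rfl, β, hβ, hc⟩ := hrep α hα
    refine (hA β hβ c hc).2 ?_
    -- If `c i` were the successor of `d i` almost everywhere, nothing would lie strictly between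
    -- the classes of `d` and `c`.
    have hpre : ∀ᶠ i in (U.toUltrafilter : Filter _), Order.IsSuccPrelimit (c i) := by
      by_contra hcon
      rw [← Ultrafilter.eventually_not] at hcon
      have hex : ∀ i, ∃ d, ¬ Order.IsSuccPrelimit (c i) → Order.succ d = c i := by
        intro i
        by_cases h : Order.IsSuccPrelimit (c i)
        · exact ⟨0, fun h' => absurd h h'⟩
        · obtain ⟨d, hd⟩ := Order.not_isSuccPrelimit_iff_mem_range_succ.1 h
          exact ⟨d, fun _ => hd⟩
      choose d hd using hex
      obtain ⟨γ, -, h1, h2⟩ := hlim.2 (U.ordOf d) (ordOf_lt_ordOf.2 (by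
        filter_upwards [hcon] with i hi
        rw [← hd i hi]
        exact Order.lt_succ _))
      obtain ⟨e, he, rfl⟩ := lt_ordOf.1 h2
      obtain ⟨i, hi, hi2, hi3⟩ := (hcon.and (he.and (ordOf_lt_ordOf.1 h1))).exists
      rw [← hd i hi, Order.lt_succ_iff] at hi2
      exact hi2.not_gt hi3
    filter_upwards [hc, hpre] with i h1 h2 using ⟨h1, Or.inl h2⟩
  · intro α hα
    obtain ⟨c, rfl, β, hβ, hc⟩ := hrep α hα
    have hβ1 := lt_ord_add_one hκ hβ
    have hβ2 := lt_ord_add_one hκ hβ1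
    have hlt1 : β < β + 1 := by simp
    have hlt2 : β + 1 < β + 1 + 1 := by simp
    -- The ordinal `β + 1` codes `β`, so it is tested one level higher, at `β + 2`, where `β` is a
    -- predecessor for almost all `i`.
    refine ⟨U.ordOf fun _ => β + 1, (hA _ hβ2 _ (Filter.Eventually.of_forall fun _ => hlt2)).2 ?_,
      ordOf_lt_ordOf.2 (hc.mono fun i hi => hi.trans hlt1)⟩
    filter_upwards [hcov _ hβ2 β (hlt1.trans hlt2)] with i hi
    exact add_one_mem_limitsWithSuccs.2 ⟨hlt2, hi⟩
  · intro z hz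
    obtain ⟨α, -, rfl⟩ := Ordinal.mem_toZFSet_iff.1 (ZFSet.mem_sep.1 hz).1
    exact ZFSet.isOrdinal_toZFSet α
  · intro hUlt
    obtain ⟨f, hf⟩ := exists_classOf_eq hUlt
    -- Otherwise a choice of disagreements `a i` represents an ordinal on which `A` and the class of
    -- `f` differ.
    have hagree : ∀ β < κ.ord, ∀ᶠ i in (U.toUltrafilter : Filter _), ∀ α < β,
        (α.toZFSet ∈ f i ↔ α ∈ F β i) := by
      intro β hβ
      by_contra hcon
      rw [← Ultrafilter.eventually_not] at hcon
      have hex : ∀ i, ∃ α, (¬ ∀ α < β, (α.toZFSet ∈ f i ↔ α ∈ F β i)) →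
          α < β ∧ ¬ (α.toZFSet ∈ f i ↔ α ∈ F β i) := by
        intro i
        by_cases h : ∀ α < β, (α.toZFSet ∈ f i ↔ α ∈ F β i)
        · exact ⟨0, fun h' => absurd h h'⟩
        · have h' := h
          push Not at h'
          obtain ⟨α, h1, h2⟩ := h'
          exact ⟨α, fun _ => ⟨h1, by tauto⟩⟩
      choose a ha using hex
      have h1 := hA β hβ a (hcon.mono fun i hi => (ha i hi).1)
      rw [← hf, toZFSet_ordOf, classOf_mem_classOf] at h1
      by_cases h2 : ∀ᶠ i in (U.toUltrafilter : Filter _), a i ∈ F β i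
      · obtain ⟨i, h3, h4, h5⟩ := (hcon.and (h2.and (h1.2 h2))).exists
        exact (ha i h3).2 (iff_of_true h5 h4)
      · have h3 := Ultrafilter.eventually_not.2 h2
        have h4 := Ultrafilter.eventually_not.2 fun h => h2 (h1.1 h)
        obtain ⟨i, h5, h6, h7⟩ := (hcon.and (h3.and h4)).exists
        exact (ha i h5).2 (iff_of_false h7 h6)
    have hgood : ∀ β < κ.ord, ∃ i : Set.Iio δ.ord, (β + 1).toZFSet ∈ f i ∧
        P i β = {γ | (γ + 1).toZFSet ∈ f i} ∩ Set.Iio β := by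
      intro β hβ
      have hβ2 := lt_ord_add_one hκ (lt_ord_add_one hκ hβ)
      have hlt1 : β < β + 1 := by simp
      have hlt2 : β + 1 < β + 1 + 1 := by simp
      obtain ⟨i, h1, h2⟩ := ((hagree _ hβ2).and (hcov _ hβ2 β (hlt1.trans hlt2))).exists
      have key : ∀ γ < β + 1, ((γ + 1).toZFSet ∈ f i ↔ γ ∈ P i (β + 1 + 1)) := by
        intro γ hγ
        have hγ2 : γ + 1 < β + 1 + 1 := by
          rw [← Order.succ_eq_add_one γ, ← Order.succ_eq_add_one (β + 1)]
          exact Order.succ_lt_succ hγ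
        rw [h1 _ hγ2, add_one_mem_limitsWithSuccs, and_iff_right hγ2]
      refine ⟨i, (key β hlt1).2 h2, ?_⟩
      rw [hcoh i _ hβ2 β h2]
      ext γ
      exact and_congr_left fun hγ => (key γ (lt_trans hγ hlt1)).symm
    have : Nonempty (Set.Iio δ.ord) := (U.toUltrafilter : Filter _).nonempty_of_neBot
    choose! g hg1 hg2 using hgood
    -- One index `i` serves cofinally many `β`, so the set decoded from `f i` is a cofinal branch.
    have hpig : ∃ i : Set.Iio δ.ord, ∀ α < κ.ord, ∃ β, α < β ∧ β < κ.ord ∧ g β = i := by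
      by_contra! hcon
      choose e he hbd using hcon
      obtain ⟨γ, hγ, hle⟩ := exists_forall_le_of_isRegular hκ
        (mk_Iio_lt_lift (Cardinal.ord_lt_ord.2 hδκ)) he
      have hlt : γ < γ + 1 := by simp
      exact hbd (g (γ + 1)) (γ + 1) ((hle _).trans_lt hlt) (lt_ord_add_one hκ hγ) rfl
    obtain ⟨i, hi⟩ := hpig
    refine hbr i {γ | (γ + 1).toZFSet ∈ f i} (fun α hα => ?_) fun α hα hακ => ?_
    · obtain ⟨β, h1, h2, rfl⟩ := hi α hα
      exact ⟨β, hg1 β h2, h1, h2⟩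
    · obtain ⟨β, h1, h2, rfl⟩ := hi α hακ
      have h3 : α ∈ P (g β) β := by
        rw [hg2 β h2]
        exact ⟨hα, h1⟩
      rw [hcoh _ β h2 α h3, hg2 β h2, Set.inter_assoc,
        Set.inter_eq_right.2 (Set.Iio_subset_Iio h1.le)]
  · intro α hα
    obtain ⟨a, ha, hlt⟩ := exists_lt_of_lt_csSup' hα
    obtain ⟨c, rfl, β, hβ, hc⟩ := hrep α (hlt.trans (hsub ha))
    -- With `β` bounding `c`, row `β` alone determines `A` below the class of `c`.
    have heq : A ∩ (U.ordOf c).toZFSet = U.classOf fun i =>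
        ZFSet.sep (fun z => z.rank ∈ F β i ∩ Set.Iio (c i)) κ.ord.toZFSet := by
      ext z
      rw [ZFSet.mem_inter, mem_classOf]
      constructor
      · rintro ⟨h1, h2⟩
        obtain ⟨γ, hγ, rfl⟩ := Ordinal.mem_toZFSet_iff.1 h2
        obtain ⟨b, hb, rfl⟩ := lt_ordOf.1 hγ
        refine ⟨fun i => (b i).toZFSet, ?_, (toZFSet_ordOf b).symm⟩
        have hbβ : ∀ᶠ i in (U.toUltrafilter : Filter _), b i < β := by
          filter_upwards [hb, hc] with i h3 h4 using h3.trans h4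
        filter_upwards [hb, hbβ, (hA β hβ b hbβ).1 h1] with i h3 h4 h5
        exact mem_sep_rank.2 ⟨b i, h4.trans hβ, ⟨h5, h3⟩, rfl⟩
      · rintro ⟨k, hk, rfl⟩
        have hk' : ∀ᶠ i in (U.toUltrafilter : Filter _), ((k i).rank ∈ F β i ∧ (k i).rank < c i) ∧
            k i = (k i).rank.toZFSet := by
          filter_upwards [hk] with i hi
          obtain ⟨γ, -, h1, h2⟩ := mem_sep_rank.1 hi
          rw [← h2, Ordinal.rank_toZFSet]
          exact ⟨h1, rfl⟩
        rw [classOf_eq_classOf.2 (hk'.mono fun i hi => hi.2), ← toZFSet_ordOf,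
          hA β hβ _ (by filter_upwards [hk', hc] with i h1 h2 using h1.1.2.trans h2),
          Ordinal.toZFSet_mem_toZFSet_iff, ordOf_lt_ordOf]
        exact ⟨hk'.mono fun i hi => hi.1.1, hk'.mono fun i hi => hi.1.2⟩
    rw [heq]
    exact classOf_mem_Ult _

end NormalUltrafilter

theorem mainTheorem6 {δ κ : Cardinal.{u}} (U : NormalUltrafilter δ) (hκ : κ.IsRegular)
    (hδκ : δ < κ) (hsq : ∃ C : Ordinal.{u} → Set Ordinal.{u}, IsSquareSequence κ C) :
    ∃ lam : Ordinal.{u}, lam.toZFSet = U.j κ.ord.toZFSet ∧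
      ∃ A : ZFSet.{u}, IsClubIn lam (ordinalsIn A) ∧ IsFresh U.Ult A := by
  obtain ⟨C, hC⟩ := hsq
  have := U.countableInterFilter
  have hne : Nonempty (Set.Iio δ.ord) := (U.toUltrafilter : Filter _).nonempty_of_neBot
  obtain ⟨P, hcoh, hcov, hbr⟩ := hC.exists_coherent_matrix
    (mk_Iio_lt_lift (Cardinal.ord_lt_ord.2 hδκ)) U.eventually_ne
  exact ⟨U.ordOf fun _ => κ.ord, NormalUltrafilter.toZFSet_ordOf _,
    NormalUltrafilter.exists_fresh_club hκ hδκ hcoh hcov hbr⟩
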